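/- **Setting.** Let $p_Q$ be a distribution over prompts, $\pi_\theta(o\mid q)$ a parametrized policy with finitely many outputs, $R(q,o)$ a reward, and $\tilde R(q,o)=R(q,o)+\epsilon$ the perturbed reward, with $\epsilon\sim\mathcal N(0,\sigma^2)$ drawn independently of the output and afresh for each sampled output. The policy is trained by gradient flow $\dot\theta(t)=\nabla\tilde J(\theta(t))$, $t\ge 0$, on the perturbed objective $\tilde J(\theta)=\mathbb E_{q\sim p_Q}\mathbb E_{o\sim\pi_\theta(\cdot\mid q)}\mathbb E_\epsilon[\tilde R(q,o)]$. For a true reward $r_G$ with values in $[-1,1]$, a prompt $x$ and $\gamma>0$, let $t_\gamma\in[0,\infty]$ be the first time $t\ge 0$ with $\mathbb E_{y\sim\pi_{\theta(t)}(\cdot\mid x)}[r_G(x,y)]\ge\mathbb E_{y\sim\pi_{\theta(0)}(\cdot\mid x)}[r_G(x,y)]+\gamma$ (infimum, $\infty$ if there is no such time). The accuracy of a reward $r$ at a prompt, with respect to a distribution $\mathcal D$ over unordered pairs of outputs, is the probability that $\operatorname{sign}(r(y)-r(y'))=\operatorname{sign}(r_G(y)-r_G(y'))$ for $\{y,y'\}\sim\mathcal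 D$ (and, for a perturbed reward, over independent noises on the two outputs). **Claim.** 1. For every prompt, policy and reward, $\operatorname{Var}_{o,\epsilon}[\tilde R(q,o)]=\operatorname{Var}_{o\sim\pi_\theta(\cdot\mid q)}[R(q,o)]+\sigma^2$. 2. If $\sigma>0$ and $R$ has accuracy $1$ with respect to $\mathcal D$, then $\tilde R$ has accuracy strictly less than $1$ with respect to $\mathcal D$. 3. (Lower bound.) Let $\pi_\theta(y\mid x)=\prod_{l=1}^{|y|}\operatorname{softmax}(f_\theta(x,y_{<l}))_{y_l}$ be an autoregressive policy over a finite vocabulary with outputs of length at most $L$, and let $R$ take values in $[-1,1]$. Suppose that the trajectory stays in an open set on which $\theta\mapsto f_\theta(x,y_{<l})$ is differentiable with Jacobian of operator norm at most $B$ (logits carrying the Euclidean norm) for all prompts and prefixes. Then there is a constant $c>0$, depending only on $\gamma,B,L$, such that for every prompt $x$ and every $r_G$, $$t_\gamma\ \ge\ c\,\Bigl(\mathbb E_{q\sim p_Q}\bigl[\operatorname{Var}_{o\sim\pi_{\theta(0)}(\cdot\mid q)}R(q,o)\bigr]+\sigma^2\Bigr)^{-1/3}.$$ 4. (Both bounds.)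 Let $\pi_\theta(y\mid x)=\operatorname{softmax}(\theta_{:,x})_y$ be a tabular policy over finitely many prompts and outputs, and let $R$ take values in $\{0,1\}$. Let $x$ be a prompt with $p_Q(x)\ge w>0$ at which $R$ is perfect, that is, has accuracy $1$ with respect to every $\mathcal D$, and let $y^\gamma$ be an output with $r_G(x,y^\gamma)\ge\mathbb E_{y\sim\pi_{\theta(0)}(\cdot\mid x)}[r_G(x,y)]+\gamma+\delta$ for some $\delta>0$. Then $$c\,\Bigl(\mathbb E_{q\sim p_Q}\bigl[\operatorname{Var}_{o\sim\pi_{\theta(0)}(\cdot\mid q)}R(q,o)\bigr]+\sigma^2\Bigr)^{-1/3}\ \le\ t_\gamma\ \le\ C\,\pi_{\theta(0)}(y^\gamma\mid x)^{-1},$$ where $c>0$ depends only on $\gamma$, and $C>0$ only on $\gamma$, $\delta$ and $w$. -/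

import Mathlib

open MeasureTheory ProbabilityTheory
open scoped NNReal ENNReal Gradient

noncomputable section

namespace ReDit

/-! ### Rewards of a single prompt

For a fixed prompt, `p y` is the probability of the output `y` under the policy and `r y` its
reward. The noise is Gaussian with mean `0` and variance `σ ^ 2`, independent of the output. -/

section SinglePrompt

variable {Y : Type*}

/-- Expected reward `E_{y ∼ p} [r y]`. -/
def mean [Fintype Y] (p r : Y → ℝ) : ℝ := ∑ y, p y * r y

/-- Reward variance `E_{y ∼ p} [(r y - E_{y' ∼ p} [r y']) ^ 2]`. -/
def rewardVar [Fintype Y] (p r : Y → ℝ) : ℝ := ∑ y, p y * (r y - mean p r) ^ 2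

/-- Law of the reward noise, `N(0, σ²)`. -/
def noise (σ : ℝ≥0) : Measure ℝ := gaussianReal 0 (σ ^ 2)

/-- Expectation of the perturbed reward `r y + ε` over independent `y ∼ p` and `ε ∼ N(0, σ²)`. -/
def noisyMean [Fintype Y] (σ : ℝ≥0) (p r : Y → ℝ) : ℝ :=
  ∑ y, p y * ∫ e, (r y + e) ∂(noise σ)

/-- Variance of the perturbed reward `r y + ε` over independent `y ∼ p` and `ε ∼ N(0, σ²)`. -/
def noisyRewardVar [Fintype Y] (σ : ℝ≥0) (p r : Y → ℝ) : ℝ :=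
  ∑ y, p y * ∫ e, (r y + e - noisyMean σ p r) ^ 2 ∂(noise σ)

/-- Indicator that `r` ranks the unordered pair of outputs as the ground truth `rG` does. -/
def agree (r rG : Y → ℝ) : Sym2 Y → ℝ :=
  Sym2.lift ⟨fun y y' =>
    if SignType.sign (r y - r y') = SignType.sign (rG y - rG y') then 1 else 0, by
      intro y y'
      beta_reduce
      rw [← neg_sub (r y') (r y), ← neg_sub (rG y') (rG y)]
      simp only [Left.sign_neg, neg_inj]⟩

/-- Accuracy of the reward `r` with respect to a distribution `D` over unordered output pairs. -/
def accuracy (D : PMF (Sym2 Y)) (r rG : Y → ℝ) : ℝ :=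
  ∑' s, (D s).toReal * agree r rG s

/-- Probability, over independent noises `ε₁, ε₂ ∼ N(0, σ²)` on the two outputs, that the perturbed
reward ranks the unordered pair as the ground truth does. -/
def noisyAgree (σ : ℝ≥0) (r rG : Y → ℝ) : Sym2 Y → ℝ :=
  Sym2.lift ⟨fun y y' =>
    ((noise σ).prod (noise σ)).real {e : ℝ × ℝ |
      SignType.sign ((r y + e.1) - (r y' + e.2)) = SignType.sign (rG y - rG y')}, by
      intro y y'
      have : IsProbabilityMeasure (noise σ) := by unfold noise; infer_instance
      have h : MeasurePreserving (MeasurableEquiv.prodComm : ℝ × ℝ ≃ᵐ ℝ × ℝ)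
          ((noise σ).prod (noise σ)) ((noise σ).prod (noise σ)) := Measure.measurePreserving_swap
      have h2 := h.measure_preimage_equiv {e : ℝ × ℝ |
        SignType.sign ((r y + e.1) - (r y' + e.2)) = SignType.sign (rG y - rG y')}
      simp only [Measure.real]
      rw [← h2]
      congr 2
      ext e
      change SignType.sign ((r y + e.2) - (r y' + e.1)) = SignType.sign (rG y - rG y') ↔
        SignType.sign ((r y' + e.1) - (r y + e.2)) = SignType.sign (rG y' - rG y)
      rw [← neg_sub (r y' + e.1) (r y + e.2), ← neg_sub (rG y') (rG y), Left.sign_neg,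
        Left.sign_neg, neg_inj]⟩

/-- Accuracy of the perturbed reward `r + ε`, the expectation being over the pair and the noise. -/
def noisyAccuracy (σ : ℝ≥0) (D : PMF (Sym2 Y)) (r rG : Y → ℝ) : ℝ :=
  ∑' s, (D s).toReal * noisyAgree σ r rG s

end SinglePrompt

/-! ### Policies

A parametrized policy is `π : Θ → X → Y → ℝ`, with `π θ x y` the probability of the output `y` on
the prompt `x`. -/

/-- The softmax of a finite vector of logits. -/
def softmax {ι : Type*} [Fintype ι] (z : ι → ℝ) (i : ι) : ℝ :=
  Real.exp (z i) / ∑ j, Real.exp (z j)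

/-- Complete outputs: generation halts at the first token in the set `eos` of end-of-sequence tokens, or
when the maximal length `L` is reached. -/
def Output (V : Type*) (eos : Set V) (L : ℕ) : Type _ :=
  {y : List V // y.length ≤ L ∧ (∀ v ∈ y.dropLast, v ∉ eos) ∧
    (y.length = L ∨ ∃ v ∈ y.getLast?, v ∈ eos)}

instance (V : Type*) [Finite V] (eos : Set V) (L : ℕ) : Finite (Output V eos L) :=
  ((List.finite_length_le V L).subset (fun _ hy => hy.1) :
    {y : List V | y.length ≤ L ∧ (∀ v ∈ y.dropLast, v ∉ eos) ∧
      (y.length = L ∨ ∃ v ∈ y.getLast?, v ∈ eos)}.Finite).to_subtype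

instance (V : Type*) [Finite V] (eos : Set V) (L : ℕ) : Fintype (Output V eos L) :=
  Fintype.ofFinite _

/-- Autoregressive policy `π_θ(y | x) = ∏_{l} softmax (f_θ (x, y_{<l}))_{y_l}` with logits `f`. -/
def arPolicy {Θ X V : Type*} [Fintype V] {eos : Set V} {L : ℕ}
    (f : Θ → X → List V → EuclideanSpace ℝ V) (θ : Θ) (x : X) (y : Output V eos L) : ℝ :=
  ∏ l : Fin y.1.length, softmax (fun v => f θ x (y.1.take l) v) (y.1.get l)

/-- Tabular policy `π_θ(y | x) = softmax (θ_{:, x})_y`. -/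
def tabularPolicy {X Y : Type*} [Fintype Y] (θ : EuclideanSpace ℝ (Y × X)) (x : X) (y : Y) : ℝ :=
  softmax (fun y' => θ (y', x)) y

/-! ### Training -/

section Training

variable {Θ X Y : Type*} [Fintype Y]

/-- Perturbed objective `E_{q ∼ pQ} E_{o ∼ π_θ(· | q)} E_ε [R q o + ε]`. -/
def noisyObjective (σ : ℝ≥0) (pQ : PMF X) (π : Θ → X → Y → ℝ) (R : X → Y → ℝ) (θ : Θ) : ℝ :=
  ∑' q, (pQ q).toReal * noisyMean σ (π θ q) (R q)

/-- Average reward variance `E_{q ∼ pQ} [Var_{o ∼ π_θ(· | q)} R q o]`. -/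
def avgRewardVar (pQ : PMF X) (π : Θ → X → Y → ℝ) (R : X → Y → ℝ) (θ : Θ) : ℝ :=
  ∑' q, (pQ q).toReal * rewardVar (π θ q) (R q)

/-- `θ` solves the gradient flow `θ' = ∇ J (θ)` (gradient ascent on `J`) on `[0, ∞)`. -/
def IsGradientFlow [NormedAddCommGroup Θ] [InnerProductSpace ℝ Θ] [CompleteSpace Θ]
    (J : Θ → ℝ) (θ : ℝ → Θ) : Prop :=
  ∀ t, 0 ≤ t → DifferentiableAt ℝ J (θ t) ∧ HasDerivWithinAt θ (∇ J (θ t)) (Set.Ici 0) t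

/-- The time `t_γ`: the infimum of the times `t ≥ 0` at which the expected reward `rG` on the prompt
`x` exceeds its initial value by at least `γ` (it is `∞` if there is none). -/
def riseTime (π : Θ → X → Y → ℝ) (θ : ℝ → Θ) (rG : X → Y → ℝ) (x : X) (γ : ℝ) : ℝ≥0∞ :=
  ⨅ (t : ℝ≥0) (_ : mean (π (θ 0) x) (rG x) + γ ≤ mean (π (θ t) x) (rG x)), (t : ℝ≥0∞)

end Training

end ReDit

end

namespace ReDit

/-! Centred noise leaves the expected reward unchanged and adds `σ ^ 2` to its variance. It has full
support, so it misranks any given pair with positive probability. The flow therefore does not see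
the noise, and both time bounds concern the unperturbed objective.

Lower bound: suppose `‖∇π(y)‖ ≤ K π(y)` for all outputs (`IsLogLipschitz`). Since `∑ ∇π(y) = 0`,
rewards may be centred, so the objective has gradient at most `K √V`, with `V` the average reward
variance. In the same way `‖∇V‖ ≤ K V`. Along the flow `V' ≤ K ^ 2 V ^ (3/2)`, so `√V` at most
doubles during a time of order `1 / (K ^ 2 √V)` (`avgRewardVar_flow_le`). Meanwhile any bounded
expected reward moves at speed `O(K ^ 2 √V)`, so a rise by `γ` takes time of order `V ^ (-1/2)`
(`le_of_rise`). As `V ≤ 1`, this dominates `(V + σ ^ 2) ^ (-1/3)`; adding `σ ^ 2` only weakens the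
bound.

Upper bound: a perfect binary reward gives `yγ` reward 1. Until the rise, the unrewarded mass `N` is
at least `δ / 2`. The odds of the unrewarded outputs against `yγ` start below `1 / π(yγ)` and fall
at rate at least `w N ^ 2`, so they would be exhausted by time `4 / (w δ ^ 2 π(yγ))`
(`riseTime_tabularPolicy_le`). -/

instance (σ : ℝ≥0) : IsProbabilityMeasure (noise σ) := by unfold noise; infer_instance

/-! ### Moments of the noise and the variance of the perturbed reward. -/

lemma memLp_id_noise (σ : ℝ≥0) : MemLp id 2 (noise σ) := by
  unfold noise
  exact_mod_cast (memLp_id_gaussianReal 2 : MemLp id (2 : ℝ≥0) (gaussianReal 0 (σ ^ 2)))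

lemma integrable_id_noise (σ : ℝ≥0) : Integrable (fun e : ℝ => e) (noise σ) :=
  (memLp_id_noise σ).integrable (by norm_num)

lemma integrable_sq_noise (σ : ℝ≥0) : Integrable (fun e : ℝ => e ^ 2) (noise σ) :=
  (memLp_id_noise σ).integrable_sq

lemma integral_id_noise (σ : ℝ≥0) : ∫ e, e ∂(noise σ) = 0 := integral_id_gaussianReal

lemma integral_sq_noise (σ : ℝ≥0) : ∫ e, e ^ 2 ∂(noise σ) = (σ : ℝ) ^ 2 := by
  have h : variance id (noise σ) = ((σ ^ 2 : ℝ≥0) : ℝ) := variance_id_gaussianReal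
  rw [variance_of_integral_eq_zero measurable_id.aemeasurable (integral_id_noise σ)]
    at h
  simpa using h

lemma integral_const_add_noise (σ : ℝ≥0) (a : ℝ) : ∫ e, (a + e) ∂(noise σ) = a := by
  rw [integral_add (integrable_const _) (integrable_id_noise σ), integral_id_noise]
  simp

lemma integral_const_add_sq_noise (σ : ℝ≥0) (a : ℝ) :
    ∫ e, (a + e) ^ 2 ∂(noise σ) = a ^ 2 + (σ : ℝ) ^ 2 := by
  have h : ∀ e : ℝ, (a + e) ^ 2 = (a ^ 2 + 2 * a * e) + e ^ 2 := fun e => by ring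
  simp_rw [h]
  have h1 : Integrable (fun e : ℝ => 2 * a * e) (noise σ) := (integrable_id_noise σ).const_mul _
  have h2 : Integrable (fun e : ℝ => a ^ 2 + 2 * a * e) (noise σ) := (integrable_const _).add h1
  rw [integral_add h2 (integrable_sq_noise σ), integral_add (integrable_const _) h1,
    integral_const_mul, integral_id_noise, integral_sq_noise]
  simp

lemma noisyMean_eq_mean {Y : Type*} [Fintype Y] (σ : ℝ≥0) (p r : Y → ℝ) :
    noisyMean σ p r = mean p r := by
  simp [noisyMean, mean, integral_const_add_noise]

theorem noisyRewardVar_eq {Y : Type*} [Fintype Y] (σ : ℝ≥0) (p r : Y → ℝ)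
    (hp : p ∈ stdSimplex ℝ Y) : noisyRewardVar σ p r = rewardVar p r + (σ : ℝ) ^ 2 := by
  have h : ∀ y, ∫ e, (r y + e - mean p r) ^ 2 ∂(noise σ) = (r y - mean p r) ^ 2 + (σ : ℝ) ^ 2 := by
    intro y
    rw [← integral_const_add_sq_noise]
    congr 1
    ext e
    ring
  simp only [noisyRewardVar, rewardVar, noisyMean_eq_mean, h, mul_add, Finset.sum_add_distrib,
    ← Finset.sum_mul, hp.2, one_mul]

/-! ### Loss of accuracy under noise. -/

/-- The product Gaussian charges every nonempty open set, so it suffices to find one on which the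
ranking is wrong. -/
lemma noisyAgree_lt_one {Y : Type*} {σ : ℝ≥0} (hσ : 0 < σ) (r rG : Y → ℝ) (s : Sym2 Y) :
    noisyAgree σ r rG s < 1 := by
  induction s with
  | _ y y' =>
  have hv : (σ ^ 2 : ℝ≥0) ≠ 0 := (pow_pos hσ 2).ne'
  have : Measure.IsOpenPosMeasure (noise σ) :=
    (gaussianReal_absolutelyContinuous' 0 hv).isOpenPosMeasure
  have key : ∀ (O A : Set (ℝ × ℝ)), IsOpen O → O.Nonempty → A ⊆ Oᶜ →
      ((noise σ).prod (noise σ)).real A < 1 := by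
    intro O A hO hne hA
    have h1 : 0 < ((noise σ).prod (noise σ)).real O :=
      ENNReal.toReal_pos (hO.measure_pos _ hne).ne' (measure_ne_top _ _)
    have h2 := measureReal_mono (μ := (noise σ).prod (noise σ)) hA
    rw [probReal_compl_eq_one_sub hO.measurableSet] at h2
    linarith
  change ((noise σ).prod (noise σ)).real {e : ℝ × ℝ |
      SignType.sign ((r y + e.1) - (r y' + e.2)) = SignType.sign (rG y - rG y')} < 1
  by_cases hs : SignType.sign (rG y - rG y') = 1
  -- A strictly positive true difference is contradicted by a negative noisy one; every other sign,
  -- ties included, by a positive one.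
  · refine key {e | (r y + e.1) - (r y' + e.2) < 0} _
      (isOpen_lt (by fun_prop) (by fun_prop)) ⟨(r y' - r y - 1, 0), by simp; linarith⟩ ?_
    intro e he he'
    simp only [Set.mem_ofPred_eq] at he he'
    rw [hs, sign_neg he'] at he
    exact absurd he (by decide)
  · refine key {e | 0 < (r y + e.1) - (r y' + e.2)} _
      (isOpen_lt (by fun_prop) (by fun_prop)) ⟨(r y' - r y + 1, 0), by simp; linarith⟩ ?_
    intro e he he'
    simp only [Set.mem_ofPred_eq] at he he'
    rw [sign_pos he'] at he
    exact hs he.symm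

lemma noisyAgree_nonneg {Y : Type*} (σ : ℝ≥0) (r rG : Y → ℝ) (s : Sym2 Y) :
    0 ≤ noisyAgree σ r rG s := by
  induction s with
  | _ y y' => exact measureReal_nonneg

lemma hasSum_toReal {X : Type*} (p : PMF X) : HasSum (fun q => (p q).toReal) 1 := by
  have h := p.tsum_coe
  have h2 : Summable fun q => (p q).toReal :=
    ENNReal.summable_toReal (by rw [h]; exact ENNReal.one_ne_top)
  have h3 := ENNReal.tsum_toReal_eq (f := fun q => p q) (fun q => p.apply_ne_top q)
  rw [h, ENNReal.toReal_one] at h3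
  rw [h3]
  exact h2.hasSum

theorem noisyAccuracy_lt_one {Y : Type*} {σ : ℝ≥0} (hσ : 0 < σ) (D : PMF (Sym2 Y))
    (r rG : Y → ℝ) : noisyAccuracy σ D r rG < 1 := by
  obtain ⟨s, hs⟩ := D.support_nonempty
  have hD := hasSum_toReal D
  have hle : ∀ s, (D s).toReal * noisyAgree σ r rG s ≤ (D s).toReal := fun s =>
    mul_le_of_le_one_right ENNReal.toReal_nonneg (noisyAgree_lt_one hσ r rG s).le
  rw [← hD.tsum_eq]
  refine Summable.tsum_lt_tsum (i := s) hle ?_ ?_ hD.summable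
  · exact mul_lt_of_lt_one_right (ENNReal.toReal_pos ((D.mem_support_iff s).1 hs) (D.apply_ne_top s))
      (noisyAgree_lt_one hσ r rG s)
  · exact Summable.of_nonneg_of_le
      (fun s => mul_nonneg ENNReal.toReal_nonneg (noisyAgree_nonneg σ r rG s)) hle hD.summable

/-! ### Averages over possibly infinitely many prompts. -/

section Weighted

variable {Θ X : Type*} [NormedAddCommGroup Θ] [NormedSpace ℝ Θ]

lemma summable_weight_mul (p : PMF X) {g : X → ℝ} {M : ℝ} (hg : ∀ q, |g q| ≤ M) :
    Summable fun q => (p q).toReal * g q := by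
  refine Summable.of_norm_bounded ((hasSum_toReal p).summable.mul_right M) fun q => ?_
  rw [norm_mul, Real.norm_of_nonneg ENNReal.toReal_nonneg]
  exact mul_le_mul_of_nonneg_left (hg q) ENNReal.toReal_nonneg

/-- Termwise differentiation on a ball inside `U`: the derivatives are uniformly bounded and the
weights summable. -/
lemma hasFDerivAt_weighted_tsum (p : PMF X) {U : Set Θ} (hU : IsOpen U) {g : X → Θ → ℝ}
    {g' : X → Θ → Θ →L[ℝ] ℝ} {M M' : ℝ}
    (hg : ∀ q, ∀ ϑ ∈ U, HasFDerivAt (g q) (g' q ϑ) ϑ)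
    (hM : ∀ q, ∀ ϑ ∈ U, |g q ϑ| ≤ M) (hM' : ∀ q, ∀ ϑ ∈ U, ‖g' q ϑ‖ ≤ M') {ϑ : Θ} (hϑ : ϑ ∈ U) :
    HasFDerivAt (fun ϑ => ∑' q, (p q).toReal * g q ϑ) (∑' q, (p q).toReal • g' q ϑ) ϑ := by
  obtain ⟨ε, hε, hball⟩ := Metric.isOpen_iff.1 hU ϑ hϑ
  refine hasFDerivAt_tsum_of_isPreconnected (s := Metric.ball ϑ ε)
    (f' := fun q ϑ => (p q).toReal • g' q ϑ)
    ((hasSum_toReal p).summable.mul_right M') Metric.isOpen_ball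
    (convex_ball ϑ ε).isPreconnected (fun q z hz => (hg q z (hball hz)).const_mul _) ?_
    (Metric.mem_ball_self hε) (summable_weight_mul p fun q => hM q ϑ hϑ) (Metric.mem_ball_self hε)
  intro q z hz
  rw [norm_smul, Real.norm_of_nonneg ENNReal.toReal_nonneg]
  exact mul_le_mul_of_nonneg_left (hM' q z (hball hz)) ENNReal.toReal_nonneg

lemma norm_weighted_tsum_le (p : PMF X) {F : Type*} [NormedAddCommGroup F] [NormedSpace ℝ F]
    {h : X → F} {b : X → ℝ} {M : ℝ} (hb : ∀ q, ‖h q‖ ≤ b q) (hM : ∀ q, b q ≤ M) :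
    ‖∑' q, (p q).toReal • h q‖ ≤ ∑' q, (p q).toReal * b q := by
  refine tsum_of_norm_bounded (summable_weight_mul p (M := M) fun q => ?_).hasSum fun q => ?_
  · rw [abs_of_nonneg ((norm_nonneg _).trans (hb q))]
    exact hM q
  · rw [norm_smul, Real.norm_of_nonneg ENNReal.toReal_nonneg]
    exact mul_le_mul_of_nonneg_left (hb q) ENNReal.toReal_nonneg

end Weighted

/-! ### Mean and variance of a bounded reward. -/

section Simplex

variable {Y : Type*} [Fintype Y] {p r : Y → ℝ}

lemma abs_mean_le_one (hp : p ∈ stdSimplex ℝ Y) (hr : ∀ y, r y ∈ Set.Icc (-1) 1) :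
    |mean p r| ≤ 1 := by
  rw [← hp.2]
  refine (Finset.abs_sum_le_sum_abs _ _).trans (Finset.sum_le_sum fun y _ => ?_)
  rw [abs_mul, abs_of_nonneg (hp.1 y)]
  exact mul_le_of_le_one_right (hp.1 y) (abs_le.2 (hr y))

lemma rewardVar_eq (hp : p ∈ stdSimplex ℝ Y) :
    rewardVar p r = mean p (fun y => r y ^ 2) - mean p r ^ 2 := by
  have h : ∀ y, p y * (r y - mean p r) ^ 2
      = p y * r y ^ 2 - 2 * mean p r * (p y * r y) + mean p r ^ 2 * p y := fun y => by ring
  simp only [rewardVar, h, Finset.sum_add_distrib, Finset.sum_sub_distrib, ← Finset.mul_sum, hp.2]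
  simp only [mean]
  ring

lemma rewardVar_nonneg (hp : p ∈ stdSimplex ℝ Y) : 0 ≤ rewardVar p r :=
  Finset.sum_nonneg fun y _ => mul_nonneg (hp.1 y) (sq_nonneg _)

lemma rewardVar_le_one (hp : p ∈ stdSimplex ℝ Y) (hr : ∀ y, r y ∈ Set.Icc (-1) 1) :
    rewardVar p r ≤ 1 := by
  rw [rewardVar_eq hp]
  have h : mean p (fun y => r y ^ 2) ≤ 1 :=
    (le_abs_self _).trans <| abs_mean_le_one hp fun y =>
      ⟨by nlinarith [sq_nonneg (r y)], by nlinarith [(hr y).1, (hr y).2]⟩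
  nlinarith [sq_nonneg (mean p r)]

end Simplex

/-! ### Policies with bounded log-gradients. -/

/-- The probabilities form a distribution and the log-probabilities of `π` have gradients bounded
by `K` on `U`. -/
structure IsLogLipschitz {Θ X Y : Type*} [NormedAddCommGroup Θ] [NormedSpace ℝ Θ] [Fintype Y]
    (π : Θ → X → Y → ℝ) (U : Set Θ) (K : ℝ) : Prop where
  mem_simplex : ∀ ϑ q, π ϑ q ∈ stdSimplex ℝ Y
  differentiableAt : ∀ ϑ ∈ U, ∀ q y, DifferentiableAt ℝ (fun ϑ' => π ϑ' q y) ϑ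
  norm_fderiv_le : ∀ ϑ ∈ U, ∀ q y, ‖fderiv ℝ (fun ϑ' => π ϑ' q y) ϑ‖ ≤ K * π ϑ q y

namespace IsLogLipschitz

variable {Θ X Y : Type*} [NormedAddCommGroup Θ] [NormedSpace ℝ Θ] [Fintype Y]
  {π : Θ → X → Y → ℝ} {U : Set Θ} {K : ℝ}

lemma hasFDerivAt_mean (h : IsLogLipschitz π U K) {ϑ : Θ} (hϑ : ϑ ∈ U) (q : X) (r : Y → ℝ) :
    HasFDerivAt (fun ϑ' => mean (π ϑ' q) r) (∑ y, r y • fderiv ℝ (fun ϑ' => π ϑ' q y) ϑ) ϑ :=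
  HasFDerivAt.fun_sum fun y _ => (h.differentiableAt ϑ hϑ q y).hasFDerivAt.mul_const (r y)

lemma sum_fderiv (h : IsLogLipschitz π U K) {ϑ : Θ} (hϑ : ϑ ∈ U) (q : X) :
    ∑ y, fderiv ℝ (fun ϑ' => π ϑ' q y) ϑ = 0 := by
  have h1 := h.hasFDerivAt_mean hϑ q fun _ => 1
  have h2 : (fun ϑ' => mean (π ϑ' q) fun _ => 1) = fun _ => 1 := by
    ext ϑ'
    simpa [mean] using (h.mem_simplex ϑ' q).2
  rw [h2] at h1
  simpa using h1.unique (hasFDerivAt_const _ _)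

lemma norm_sum_le (h : IsLogLipschitz π U K) {ϑ : Θ} (hϑ : ϑ ∈ U) (q : X) {r b : Y → ℝ}
    (hb : ∀ y, |r y| ≤ b y) :
    ‖∑ y, r y • fderiv ℝ (fun ϑ' => π ϑ' q y) ϑ‖ ≤ K * mean (π ϑ q) b := by
  rw [mean, Finset.mul_sum]
  refine norm_sum_le_of_le _ fun y _ => ?_
  rw [norm_smul, Real.norm_eq_abs, mul_comm, ← mul_assoc]
  exact mul_le_mul (h.norm_fderiv_le ϑ hϑ q y) (hb y) (abs_nonneg _)
    ((norm_nonneg _).trans (h.norm_fderiv_le ϑ hϑ q y))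

lemma sum_smul_sub (h : IsLogLipschitz π U K) {ϑ : Θ} (hϑ : ϑ ∈ U) (q : X) (r : Y → ℝ) (m : ℝ) :
    ∑ y, (r y - m) • fderiv ℝ (fun ϑ' => π ϑ' q y) ϑ
      = ∑ y, r y • fderiv ℝ (fun ϑ' => π ϑ' q y) ϑ := by
  simp only [sub_smul, Finset.sum_sub_distrib, ← Finset.smul_sum, h.sum_fderiv hϑ, smul_zero,
    sub_zero]

/-- Centre the reward, then apply `|a| ≤ (a ^ 2 / l + l) / 2`. The free parameter `l` replaces
Cauchy–Schwarz: the bound is linear in the variance, so it averages over prompts, and `l` of the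
size of the standard deviation recovers the square root. -/
lemma norm_deriv_mean_le (h : IsLogLipschitz π U K) {ϑ : Θ} (hϑ : ϑ ∈ U) (q : X)
    {r : Y → ℝ} {l : ℝ} (hl : 0 < l) :
    ‖∑ y, r y • fderiv ℝ (fun ϑ' => π ϑ' q y) ϑ‖ ≤ K * ((rewardVar (π ϑ q) r / l + l) / 2) := by
  rw [← h.sum_smul_sub hϑ q r (mean (π ϑ q) r)]
  refine (h.norm_sum_le hϑ q
    (b := fun y => ((r y - mean (π ϑ q) r) ^ 2 / l + l) / 2) fun y => ?_).trans_eq ?_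
  · have h1 : ∀ a : ℝ, |a| ≤ (a ^ 2 / l + l) / 2 := by
      intro a
      have : (a ^ 2 / l + l) / 2 - |a| = (|a| - l) ^ 2 / (2 * l) := by
        rw [← sq_abs a]
        field_simp
        ring
      have h2 : 0 ≤ (|a| - l) ^ 2 / (2 * l) := by positivity
      linarith
    exact h1 _
  · have h2 : ∀ y, π ϑ q y * (((r y - mean (π ϑ q) r) ^ 2 / l + l) / 2)
        = π ϑ q y * (r y - mean (π ϑ q) r) ^ 2 / (2 * l) + l / 2 * π ϑ q y := fun y => by
      field_simp
    congr 1
    rw [mean, Finset.sum_congr rfl fun y _ => h2 y, Finset.sum_add_distrib, ← Finset.mul_sum,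
      (h.mem_simplex ϑ q).2, ← Finset.sum_div, ← rewardVar]
    field_simp

lemma hasFDerivAt_rewardVar (h : IsLogLipschitz π U K) {ϑ : Θ} (hϑ : ϑ ∈ U) (q : X) (r : Y → ℝ) :
    HasFDerivAt (fun ϑ' => rewardVar (π ϑ' q) r)
      (∑ y, ((r y - mean (π ϑ q) r) ^ 2) • fderiv ℝ (fun ϑ' => π ϑ' q y) ϑ) ϑ := by
  have h1 : (fun ϑ' => rewardVar (π ϑ' q) r)
      = fun ϑ' => mean (π ϑ' q) (fun y => r y ^ 2) - mean (π ϑ' q) r ^ 2 := by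
    ext ϑ'
    exact rewardVar_eq (h.mem_simplex ϑ' q)
  rw [h1]
  refine ((h.hasFDerivAt_mean hϑ q _).sub ((h.hasFDerivAt_mean hϑ q r).pow 2)).congr_fderiv ?_
  -- The term free of `y` is invisible, as the probabilities have total derivative zero.
  have h2 : ∀ y, (r y - mean (π ϑ q) r) ^ 2
      = r y ^ 2 - (2 * mean (π ϑ q) r) * r y - (-(mean (π ϑ q) r) ^ 2) := fun y => by ring
  simp only [h2]
  rw [h.sum_smul_sub hϑ]
  simp only [sub_smul, Finset.sum_sub_distrib, mul_smul, ← Finset.smul_sum]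
  congr 1
  ext v
  simp [mul_assoc]

lemma norm_deriv_rewardVar_le (h : IsLogLipschitz π U K) {ϑ : Θ} (hϑ : ϑ ∈ U) (q : X)
    (r : Y → ℝ) :
    ‖∑ y, ((r y - mean (π ϑ q) r) ^ 2) • fderiv ℝ (fun ϑ' => π ϑ' q y) ϑ‖
      ≤ K * rewardVar (π ϑ q) r :=
  h.norm_sum_le hϑ q fun _ => (abs_of_nonneg (sq_nonneg _)).le

variable (pQ : PMF X) {R : X → Y → ℝ}

lemma hasFDerivAt_noisyObjective (h : IsLogLipschitz π U K) (hU : IsOpen U)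
    (hR : ∀ q y, R q y ∈ Set.Icc (-1) 1) (σ : ℝ≥0) {ϑ : Θ} (hϑ : ϑ ∈ U) :
    HasFDerivAt (noisyObjective σ pQ π R)
      (∑' q, (pQ q).toReal • ∑ y, R q y • fderiv ℝ (fun ϑ' => π ϑ' q y) ϑ) ϑ := by
  have h1 : noisyObjective σ pQ π R = fun ϑ' => ∑' q, (pQ q).toReal * mean (π ϑ' q) (R q) := by
    ext ϑ'
    simp only [noisyObjective, noisyMean_eq_mean]
  rw [h1]
  refine hasFDerivAt_weighted_tsum pQ hU (M := 1) (M' := K)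
    (g' := fun q ϑ => ∑ y, R q y • fderiv ℝ (fun ϑ' => π ϑ' q y) ϑ)
    (fun q z hz => h.hasFDerivAt_mean hz q (R q))
    (fun q z _ => abs_mean_le_one (h.mem_simplex z q) (hR q)) (fun q z hz => ?_) hϑ
  refine (h.norm_sum_le hz q (b := fun _ => 1) fun y => abs_le.2 (hR q y)).trans_eq ?_
  simp [mean, (h.mem_simplex z q).2]

lemma avgRewardVar_nonneg (h : IsLogLipschitz π U K) (ϑ : Θ) : 0 ≤ avgRewardVar pQ π R ϑ :=
  tsum_nonneg fun q => mul_nonneg ENNReal.toReal_nonneg (rewardVar_nonneg (h.mem_simplex ϑ q))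

lemma abs_rewardVar_le_one (h : IsLogLipschitz π U K) (hR : ∀ q y, R q y ∈ Set.Icc (-1) 1)
    (ϑ : Θ) (q : X) : |rewardVar (π ϑ q) (R q)| ≤ 1 := by
  rw [abs_of_nonneg (rewardVar_nonneg (h.mem_simplex ϑ q))]
  exact rewardVar_le_one (h.mem_simplex ϑ q) (hR q)

lemma avgRewardVar_le_one (h : IsLogLipschitz π U K) (hR : ∀ q y, R q y ∈ Set.Icc (-1) 1)
    (ϑ : Θ) : avgRewardVar pQ π R ϑ ≤ 1 := by
  rw [← (hasSum_toReal pQ).tsum_eq]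
  exact Summable.tsum_le_tsum (fun q => mul_le_of_le_one_right ENNReal.toReal_nonneg
    (rewardVar_le_one (h.mem_simplex ϑ q) (hR q)))
    (summable_weight_mul pQ fun q => h.abs_rewardVar_le_one hR ϑ q) (hasSum_toReal pQ).summable

lemma norm_deriv_objective_le (h : IsLogLipschitz π U K) (hK : 0 ≤ K)
    (hR : ∀ q y, R q y ∈ Set.Icc (-1) 1) {ϑ : Θ} (hϑ : ϑ ∈ U) {l : ℝ} (hl : 0 < l) :
    ‖∑' q, (pQ q).toReal • ∑ y, R q y • fderiv ℝ (fun ϑ' => π ϑ' q y) ϑ‖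
      ≤ K * ((avgRewardVar pQ π R ϑ / l + l) / 2) := by
  refine (norm_weighted_tsum_le pQ (M := K * ((1 / l + l) / 2))
    (fun q => h.norm_deriv_mean_le hϑ q hl) fun q => ?_).trans_eq ?_
  · have := rewardVar_le_one (h.mem_simplex ϑ q) (hR q)
    gcongr
  · have hs := summable_weight_mul pQ fun q => h.abs_rewardVar_le_one hR ϑ q
    have h1 : ∀ q, (pQ q).toReal * (K * ((rewardVar (π ϑ q) (R q) / l + l) / 2))
        = (K / (2 * l)) * ((pQ q).toReal * rewardVar (π ϑ q) (R q))
          + (K * l / 2) * (pQ q).toReal := fun q => by field_simp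
    simp only [h1]
    rw [(hs.mul_left _).tsum_add ((hasSum_toReal pQ).summable.mul_left _), tsum_mul_left,
      tsum_mul_left, (hasSum_toReal pQ).tsum_eq, ← avgRewardVar]
    field_simp

lemma hasFDerivAt_avgRewardVar (h : IsLogLipschitz π U K) (hU : IsOpen U) (hK : 0 ≤ K)
    (hR : ∀ q y, R q y ∈ Set.Icc (-1) 1) {ϑ : Θ} (hϑ : ϑ ∈ U) :
    ∃ V' : Θ →L[ℝ] ℝ, HasFDerivAt (avgRewardVar pQ π R) V' ϑ ∧
      ‖V'‖ ≤ K * avgRewardVar pQ π R ϑ := by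
  refine ⟨_, hasFDerivAt_weighted_tsum pQ hU (M := 1) (M' := K)
    (g := fun q ϑ => rewardVar (π ϑ q) (R q))
    (g' := fun q ϑ => ∑ y, ((R q y - mean (π ϑ q) (R q)) ^ 2) • fderiv ℝ (fun ϑ' => π ϑ' q y) ϑ)
    (fun q z hz => h.hasFDerivAt_rewardVar hz q (R q))
    (fun q z _ => h.abs_rewardVar_le_one hR z q) (fun q z hz => ?_) hϑ, ?_⟩
  · exact (h.norm_deriv_rewardVar_le hz q (R q)).trans
      (mul_le_of_le_one_right hK (rewardVar_le_one (h.mem_simplex z q) (hR q)))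
  · refine (norm_weighted_tsum_le pQ (M := K)
      (fun q => h.norm_deriv_rewardVar_le hϑ q (R q)) fun q => ?_).trans_eq ?_
    · exact mul_le_of_le_one_right hK (rewardVar_le_one (h.mem_simplex ϑ q) (hR q))
    · rw [avgRewardVar, ← tsum_mul_left]
      exact tsum_congr fun q => by ring

end IsLogLipschitz

/-! ### Variance growth along the flow and the lower bound. -/

section Flow

variable {Θ X Y : Type*} [NormedAddCommGroup Θ] [InnerProductSpace ℝ Θ] [CompleteSpace Θ]
  [Fintype Y] {π : Θ → X → Y → ℝ} {U : Set Θ} {K : ℝ} {pQ : PMF X} {R rG : X → Y → ℝ}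
  {σ : ℝ≥0} {θ : ℝ → Θ} {x : X} {γ : ℝ}

lemma norm_gradient_noisyObjective_le (h : IsLogLipschitz π U K) (hU : IsOpen U) (hK : 0 ≤ K)
    (hR : ∀ q y, R q y ∈ Set.Icc (-1) 1) {ϑ : Θ} (hϑ : ϑ ∈ U) {l : ℝ} (hl : 0 < l)
    (hV : avgRewardVar pQ π R ϑ ≤ l ^ 2) : ‖∇ (noisyObjective σ pQ π R) ϑ‖ ≤ K * l := by
  rw [gradient, LinearIsometryEquiv.norm_map,
    (h.hasFDerivAt_noisyObjective pQ hU hR σ hϑ).fderiv]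
  refine (h.norm_deriv_objective_le pQ hK hR hϑ hl).trans (mul_le_mul_of_nonneg_left ?_ hK)
  have : avgRewardVar pQ π R ϑ / l ≤ l := by
    rw [div_le_iff₀ hl]
    linarith
  linarith

/-- If the average reward variance is initially at most `l ^ 2`, it stays at most `(2 * l) ^ 2` up to
time `(2 * K ^ 2 * l)⁻¹`. -/
lemma avgRewardVar_flow_le (h : IsLogLipschitz π U K) (hU : IsOpen U) (hK : 0 < K)
    (hR : ∀ q y, R q y ∈ Set.Icc (-1) 1) (hflow : IsGradientFlow (noisyObjective σ pQ π R) θ)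
    (hθ : ∀ t, 0 ≤ t → θ t ∈ U) {l : ℝ} (hl : 0 < l) (hV : avgRewardVar pQ π R (θ 0) ≤ l ^ 2)
    {t : ℝ} (ht : 0 ≤ t) (htl : K ^ 2 * t ≤ l⁻¹ / 2) :
    avgRewardVar pQ π R (θ t) ≤ (2 * l) ^ 2 := by
  have hderiv : ∀ s, 0 ≤ s → ∃ W' : ℝ, HasDerivWithinAt (fun s => avgRewardVar pQ π R (θ s)) W'
      (Set.Ici 0) s ∧ W' ≤ K * avgRewardVar pQ π R (θ s) * ‖∇ (noisyObjective σ pQ π R) (θ s)‖ := by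
    intro s hs
    obtain ⟨V', hV', hn⟩ := h.hasFDerivAt_avgRewardVar pQ hU hK.le hR (hθ s hs)
    refine ⟨_, hV'.comp_hasDerivWithinAt s (hflow s hs).2, ?_⟩
    exact (le_abs_self _).trans ((V'.le_opNorm _).trans
      (mul_le_mul_of_nonneg_right hn (norm_nonneg _)))
  choose! W' hW' hW'le using hderiv
  have hpos : ∀ s ∈ Set.Icc 0 t, l⁻¹ / 2 ≤ l⁻¹ - K ^ 2 * s := by
    intro s hs
    have := mul_le_mul_of_nonneg_left hs.2 (sq_nonneg K)
    linarith
  have hl2 : 0 < l⁻¹ / 2 := by positivity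
  -- The barrier is `m ^ 2` with `m' = K ^ 2 m ^ 2`. At contact the variance grows at rate at most
  -- `K ^ 2 m ^ 3`, half the barrier's, which gives the strict inequality needed for comparison.
  have hB : ∀ s ∈ Set.Icc 0 t, HasDerivAt (fun s => ((l⁻¹ - K ^ 2 * s)⁻¹) ^ 2)
      (2 * K ^ 2 * ((l⁻¹ - K ^ 2 * s)⁻¹) ^ 3) s := by
    intro s hs
    have hne : l⁻¹ - K ^ 2 * s ≠ 0 := (hl2.trans_le (hpos s hs)).ne'
    have h1 : HasDerivAt (fun s => l⁻¹ - K ^ 2 * s) (-(K ^ 2)) s := by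
      simpa using ((hasDerivAt_id s).const_mul (K ^ 2)).const_sub l⁻¹
    refine ((h1.fun_inv hne).fun_pow 2).congr_deriv ?_
    push_cast
    field_simp
  have key := image_le_of_deriv_right_lt_deriv_boundary' (a := 0) (b := t)
    (f := fun s => avgRewardVar pQ π R (θ s)) (f' := W')
    (fun s hs => ((hW' s hs.1).continuousWithinAt.mono Set.Icc_subset_Ici_self))
    (fun s hs => (hW' s hs.1).mono (Set.Ici_subset_Ici.2 hs.1))
    (B := fun s => ((l⁻¹ - K ^ 2 * s)⁻¹) ^ 2) (by simpa using hV)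
    (fun s hs => (hB s hs).continuousAt.continuousWithinAt)
    (fun s hs => (hB s (Set.Ico_subset_Icc_self hs)).hasDerivWithinAt) ?_
    (Set.right_mem_Icc.2 ht)
  · refine key.trans ?_
    have h1 := hpos t (Set.right_mem_Icc.2 ht)
    have h2 : (l⁻¹ - K ^ 2 * t)⁻¹ ≤ 2 * l := by
      refine (inv_anti₀ hl2 h1).trans_eq ?_
      field_simp
    have h3 : 0 ≤ (l⁻¹ - K ^ 2 * t)⁻¹ := inv_nonneg.2 (hl2.le.trans h1)
    exact pow_le_pow_left₀ h3 h2 2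
  · intro s hs hsB
    have hm : 0 < (l⁻¹ - K ^ 2 * s)⁻¹ :=
      inv_pos.2 (hl2.trans_le (hpos s (Set.Ico_subset_Icc_self hs)))
    have h1 := norm_gradient_noisyObjective_le (σ := σ) h hU hK.le hR (hθ s hs.1) hm hsB.le
    have h2 := hW'le s hs.1
    rw [hsB] at h2
    generalize (l⁻¹ - K ^ 2 * s)⁻¹ = m at *
    have h3 : K * m ^ 2 * ‖∇ (noisyObjective σ pQ π R) (θ s)‖ ≤ K * m ^ 2 * (K * m) :=
      mul_le_mul_of_nonneg_left h1 (by positivity)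
    have h4 : 0 < K ^ 2 * m ^ 3 := by positivity
    nlinarith

/-- While the variance is at most `(2 * l) ^ 2`, the parameters move at speed at most `2 K l` and
the expected `rG` at most `K` times faster. The minimum with 1 keeps `t` within the window where
that variance bound holds. -/
lemma le_of_rise (h : IsLogLipschitz π U K) (hU : IsOpen U) (hK : 0 < K)
    (hR : ∀ q y, R q y ∈ Set.Icc (-1) 1) (hrG : ∀ q y, rG q y ∈ Set.Icc (-1) 1)
    (hflow : IsGradientFlow (noisyObjective σ pQ π R) θ)
    (hθ : ∀ t, 0 ≤ t → θ t ∈ U) {l : ℝ} (hl : 0 < l) (hV : avgRewardVar pQ π R (θ 0) ≤ l ^ 2)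
    {t : ℝ} (ht : 0 ≤ t) (hrise : mean (π (θ 0) x) (rG x) + γ ≤ mean (π (θ t) x) (rG x)) :
    min 1 γ / (2 * K ^ 2) * l⁻¹ ≤ t := by
  by_contra! hlt
  have hlt' : 2 * K ^ 2 * (l * t) < min 1 γ := by
    rw [div_mul_eq_mul_div, lt_div_iff₀ (by positivity), ← div_eq_mul_inv, lt_div_iff₀ hl] at hlt
    linarith
  have htl : ∀ s ∈ Set.Icc 0 t, K ^ 2 * s ≤ l⁻¹ / 2 := by
    intro s hs
    have h1 : 2 * K ^ 2 * (l * s) ≤ 2 * K ^ 2 * (l * t) := by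
      have := hs.2
      gcongr
    have h2 : 2 * K ^ 2 * (l * s) ≤ 1 := h1.trans (hlt'.le.trans (min_le_left _ _))
    rw [le_div_iff₀ two_pos, ← one_div, le_div_iff₀ hl]
    linarith
  have hbound := Convex.norm_image_sub_le_of_norm_hasDerivWithin_le (C := K * (K * (2 * l)))
    (f := fun s => mean (π (θ s) x) (rG x)) (s := Set.Icc 0 t)
    (fun s hs => ((h.hasFDerivAt_mean (hθ s hs.1) x (rG x)).comp_hasDerivWithinAt s
      (hflow s hs.1).2).mono Set.Icc_subset_Ici_self) ?_ (convex_Icc 0 t)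
    (Set.left_mem_Icc.2 ht) (Set.right_mem_Icc.2 ht)
  · rw [sub_zero, Real.norm_of_nonneg ht] at hbound
    have h1 := (le_abs_self _).trans hbound
    have h2 := min_le_right 1 γ
    beta_reduce at h1
    nlinarith
  · intro s hs
    refine (ContinuousLinearMap.le_opNorm _ _).trans ?_
    refine mul_le_mul ?_ ?_ (norm_nonneg _) hK.le
    · refine (h.norm_sum_le (hθ s hs.1) x (b := fun _ => 1)
        fun y => abs_le.2 (hrG x y)).trans_eq ?_
      simp [mean, (h.mem_simplex (θ s) x).2]
    · exact norm_gradient_noisyObjective_le h hU hK.le hR (hθ s hs.1) (by positivity)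
        (avgRewardVar_flow_le h hU hK hR hflow hθ hl hV hs.1 (htl s hs))

/-- Lower bound on the rise time of the expected reward along the gradient flow. -/
theorem le_riseTime (h : IsLogLipschitz π U K) (hU : IsOpen U) (hK : 0 < K) (hγ : 0 < γ)
    (hR : ∀ q y, R q y ∈ Set.Icc (-1) 1) (hrG : ∀ q y, rG q y ∈ Set.Icc (-1) 1)
    (hflow : IsGradientFlow (noisyObjective σ pQ π R) θ) (hθ : ∀ t, 0 ≤ t → θ t ∈ U) :
    ENNReal.ofReal (min 1 γ / (2 * K ^ 2)) * ENNReal.ofReal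
        (avgRewardVar pQ π R (θ 0) + (σ : ℝ) ^ 2) ^ (-(1 / 3) : ℝ)
      ≤ riseTime π θ rG x γ := by
  refine le_iInf fun t => le_iInf fun ht => ?_
  have hV0 := h.avgRewardVar_nonneg (R := R) pQ (θ 0)
  have hV1 := h.avgRewardVar_le_one pQ hR (θ 0)
  set V := avgRewardVar pQ π R (θ 0) with hVdef
  have hc : 0 < min 1 γ / (2 * K ^ 2) := by positivity
  have hrise : ∀ l : ℝ, 0 < l → V ≤ l ^ 2 → min 1 γ / (2 * K ^ 2) * l⁻¹ ≤ t := fun l hl hVl =>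
    le_of_rise h hU hK hR hrG hflow hθ hl hVl t.2 ht
  set c := min 1 γ / (2 * K ^ 2)
  rcases (add_nonneg hV0 (sq_nonneg (σ : ℝ))).eq_or_lt with h0 | hpos
  · exfalso
    have hVz : V = 0 := by nlinarith [sq_nonneg (σ : ℝ)]
    -- With zero variance every `l > 0` is admissible; this one forces `t + 1 ≤ t`.
    have h1 := hrise (c / (t + 1)) (by positivity) (by rw [hVz]; positivity)
    rw [inv_div, mul_div_cancel₀ _ hc.ne'] at h1
    linarith
  · rw [ENNReal.ofReal_rpow_of_pos hpos, ← ENNReal.ofReal_mul hc.le]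
    refine ENNReal.ofReal_le_of_le_toReal ?_
    rw [ENNReal.coe_toReal]
    set S := V + (σ : ℝ) ^ 2
    have hVS : V ≤ S := le_add_of_nonneg_right (sq_nonneg _)
    have hm : 0 < min S 1 := lt_min hpos one_pos
    -- Capping at 1 is allowed since `V ≤ 1`; on a base at most 1 the exponent `-1/2` dominates
    -- `-1/3`.
    refine le_trans ?_ (hrise (√(min S 1)) (Real.sqrt_pos.2 hm) ?_)
    · refine mul_le_mul_of_nonneg_left ?_ hc.le
      rw [Real.sqrt_eq_rpow, ← Real.rpow_neg hm.le]
      calc S ^ (-(1 / 3) : ℝ) ≤ (min S 1) ^ (-(1 / 3) : ℝ) :=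
            Real.rpow_le_rpow_of_nonpos hm (min_le_left _ _) (by norm_num)
        _ ≤ (min S 1) ^ (-(1 / 2) : ℝ) :=
            Real.rpow_le_rpow_of_exponent_ge hm (min_le_right _ _) (by norm_num)
    · rw [Real.sq_sqrt hm.le]
      exact le_min hVS hV1

end Flow

/-! ### Log-gradients of softmax and of products. -/

section Softmax

variable {ι : Type*} [Fintype ι]

lemma sum_exp_pos [Nonempty ι] (z : ι → ℝ) : 0 < ∑ j, Real.exp (z j) :=
  Finset.sum_pos (fun _ _ => Real.exp_pos _) Finset.univ_nonempty

lemma softmax_pos (z : ι → ℝ) (i : ι) : 0 < softmax z i :=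
  have : Nonempty ι := ⟨i⟩
  div_pos (Real.exp_pos _) (sum_exp_pos z)

lemma sum_softmax [Nonempty ι] (z : ι → ℝ) : ∑ i, softmax z i = 1 := by
  simp only [softmax, ← Finset.sum_div]
  exact div_self (sum_exp_pos z).ne'

lemma softmax_mem_stdSimplex [Nonempty ι] (z : ι → ℝ) : softmax z ∈ stdSimplex ℝ ι :=
  ⟨fun i => (softmax_pos z i).le, sum_softmax z⟩

variable {E : Type*} [NormedAddCommGroup E] [NormedSpace ℝ E]

lemma hasFDerivAt_softmax {z : E → ι → ℝ} {z' : ι → E →L[ℝ] ℝ} {ϑ : E}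
    (hz : ∀ i, HasFDerivAt (fun ϑ => z ϑ i) (z' i) ϑ) (i : ι) :
    HasFDerivAt (fun ϑ => softmax (z ϑ) i)
      (softmax (z ϑ) i • (z' i - ∑ j, softmax (z ϑ) j • z' j)) ϑ := by
  have : Nonempty ι := ⟨i⟩
  have hs := (sum_exp_pos (z ϑ)).ne'
  have h1 := (hz i).exp.mul ((hasDerivAt_inv hs).comp_hasFDerivAt ϑ
    (HasFDerivAt.fun_sum (u := Finset.univ) fun j _ => (hz j).exp))
  refine (h1.congr_fderiv ?_).congr_of_eventuallyEq (.of_forall fun ϑ' => div_eq_mul_inv _ _)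
  ext v
  simp [softmax, div_mul_eq_mul_div, ← Finset.sum_div]
  field_simp
  ring

/-- The log-gradient is a logit gradient minus the policy average of all of them, hence at most `2 *
B` whatever the number of logits. -/
lemma norm_fderiv_softmax_le {z : E → ι → ℝ} {z' : ι → E →L[ℝ] ℝ} {ϑ : E} {B : ℝ}
    (hz : ∀ i, HasFDerivAt (fun ϑ => z ϑ i) (z' i) ϑ) (hB : ∀ i, ‖z' i‖ ≤ B) (i : ι) :
    DifferentiableAt ℝ (fun ϑ => softmax (z ϑ) i) ϑ ∧
      ‖fderiv ℝ (fun ϑ => softmax (z ϑ) i) ϑ‖ ≤ 2 * B * softmax (z ϑ) i := by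
  have : Nonempty ι := ⟨i⟩
  have h := hasFDerivAt_softmax hz i
  refine ⟨h.differentiableAt, ?_⟩
  rw [h.fderiv, norm_smul, Real.norm_of_nonneg (softmax_pos _ _).le, mul_comm]
  refine mul_le_mul_of_nonneg_right ?_ (softmax_pos _ _).le
  refine (norm_sub_le _ _).trans ?_
  rw [two_mul]
  refine add_le_add (hB i) ?_
  calc _ ≤ ∑ j, softmax (z ϑ) j * B := norm_sum_le_of_le _ fun j _ => by
        rw [norm_smul, Real.norm_of_nonneg (softmax_pos _ _).le]
        exact mul_le_mul_of_nonneg_left (hB j) (softmax_pos _ _).le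
    _ = B := by rw [← Finset.sum_mul, sum_softmax, one_mul]

lemma norm_fderiv_softmax_euclidean_le {z : E → EuclideanSpace ℝ ι} {ϑ : E} {B : ℝ}
    (hz : DifferentiableAt ℝ z ϑ) (hB : ‖fderiv ℝ z ϑ‖ ≤ B) (i : ι) :
    DifferentiableAt ℝ (fun ϑ => softmax (fun v => z ϑ v) i) ϑ ∧
      ‖fderiv ℝ (fun ϑ => softmax (fun v => z ϑ v) i) ϑ‖
        ≤ 2 * B * softmax (fun v => z ϑ v) i :=
  norm_fderiv_softmax_le (z := fun ϑ v => z ϑ v)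
    (fun j => (EuclideanSpace.proj (𝕜 := ℝ) j).hasFDerivAt.comp ϑ hz.hasFDerivAt)
    (fun j => (ContinuousLinearMap.opNorm_le_bound _ (norm_nonneg _) fun v =>
      (PiLp.norm_apply_le _ j).trans ((fderiv ℝ z ϑ).le_opNorm v)).trans hB) i

end Softmax

/-- Log-gradients of the factors add up. -/
lemma norm_fderiv_prod_le {E ι : Type*} [NormedAddCommGroup E] [NormedSpace ℝ E]
    {u : Finset ι} {g : ι → E → ℝ} {ϑ : E} {B : ℝ}
    (hg : ∀ i ∈ u, DifferentiableAt ℝ (g i) ϑ) (h0 : ∀ i ∈ u, 0 ≤ g i ϑ)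
    (hB : ∀ i ∈ u, ‖fderiv ℝ (g i) ϑ‖ ≤ B * g i ϑ) :
    DifferentiableAt ℝ (fun ϑ => ∏ i ∈ u, g i ϑ) ϑ ∧
      ‖fderiv ℝ (fun ϑ => ∏ i ∈ u, g i ϑ) ϑ‖ ≤ u.card * B * ∏ i ∈ u, g i ϑ := by
  classical
  have h := HasFDerivAt.finsetProd fun i hi => (hg i hi).hasFDerivAt
  refine ⟨h.differentiableAt, ?_⟩
  rw [h.fderiv, mul_assoc,
    ← nsmul_eq_mul]
  refine (norm_sum_le _ _).trans (Finset.sum_le_card_nsmul _ _ _ fun i hi => ?_)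
  have h1 : 0 ≤ ∏ j ∈ u.erase i, g j ϑ :=
    Finset.prod_nonneg fun j hj => h0 j (Finset.mem_of_mem_erase hj)
  rw [norm_smul, Real.norm_of_nonneg h1, ← Finset.mul_prod_erase u _ hi]
  calc _ ≤ (∏ j ∈ u.erase i, g j ϑ) * (B * g i ϑ) := mul_le_mul_of_nonneg_left (hB i hi) h1
    _ = _ := by ring

/-! ### Autoregressive policies. -/

section Autoregressive

variable {V : Type*}

open Classical in
/-- The finset of complete outputs of maximal length `L`, generated token by token. -/
noncomputable def completions [Fintype V] (eos : Set V) : ℕ → Finset (List V)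
  | 0 => {[]}
  | L + 1 => Finset.univ.biUnion fun v =>
      if v ∈ eos then {[v]} else (completions eos L).image (v :: ·)

lemma mem_completions [Fintype V] (eos : Set V) (L : ℕ) (y : List V) :
    y ∈ completions eos L ↔ y.length ≤ L ∧ (∀ v ∈ y.dropLast, v ∉ eos) ∧
      (y.length = L ∨ ∃ v ∈ y.getLast?, v ∈ eos) := by
  induction L generalizing y with
  | zero => cases y <;> simp [completions]
  | succ L ih =>
    cases y with
    | nil =>
      simp only [completions, Finset.mem_biUnion, Finset.mem_univ, true_and]
      constructor
      · rintro ⟨v, hv⟩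
        split_ifs at hv <;> simp at hv
      · simp
    | cons a y =>
      have h1 : a :: y ∈ completions eos (L + 1) ↔
          (a ∈ eos ∧ y = []) ∨ (a ∉ eos ∧ y ∈ completions eos L) := by
        simp only [completions, Finset.mem_biUnion, Finset.mem_univ, true_and]
        constructor
        · rintro ⟨v, hv⟩
          split_ifs at hv with hve
          · simp at hv
            obtain ⟨rfl, rfl⟩ := hv
            exact Or.inl ⟨hve, rfl⟩
          · simp at hv
            obtain ⟨hy, rfl⟩ := hv
            exact Or.inr ⟨hve, hy⟩
        · rintro (⟨ha, rfl⟩ | ⟨ha, hy⟩)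
          · exact ⟨a, by simp [ha]⟩
          · exact ⟨a, by simp [ha, hy]⟩
      rw [h1, ih]
      cases y with
      | nil => by_cases ha : a ∈ eos <;> (simp [ha]; try omega)
      | cons b y => simp [List.dropLast_cons_of_ne_nil, and_assoc]; tauto

/-- Probability that an autoregressive model with next-token probabilities `p` emits `y`. -/
noncomputable def seqProb (p : List V → V → ℝ) (y : List V) : ℝ :=
  ∏ l : Fin y.length, p (y.take l) (y.get l)

lemma seqProb_cons (p : List V → V → ℝ) (a : V) (y : List V) :
    seqProb p (a :: y) = p [] a * seqProb (fun s => p (a :: s)) y := by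
  simp only [seqProb, List.length_cons]
  rw [Fin.prod_univ_succ]
  simp

/-- Condition on the first token: generation either stops there or continues as a model with one
step fewer and a shifted prefix. -/
lemma sum_seqProb_completions [Fintype V] (eos : Set V) (L : ℕ) (p : List V → V → ℝ)
    (hp : ∀ s, ∑ v, p s v = 1) : ∑ y ∈ completions eos L, seqProb p y = 1 := by
  classical
  induction L generalizing p with
  | zero => simp [completions, seqProb]
  | succ L ih =>
    rw [completions, Finset.sum_biUnion, ← hp []]
    · refine Finset.sum_congr rfl fun v _ => ?_
      split_ifs
      · simp [seqProb]
      · rw [Finset.sum_image fun a _ b _ hab => List.tail_eq_of_cons_eq hab]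
        simp only [seqProb_cons, ← Finset.mul_sum]
        rw [ih _ fun s => hp (v :: s), mul_one]
    · intro v _ v' _ hvv'
      have h1 : ∀ w (y : List V), y ∈ (if w ∈ eos then {[w]} else
          (completions eos L).image (w :: ·) : Finset (List V)) → y.head? = some w := by
        intro w y hy
        split_ifs at hy
        · simp_all
        · obtain ⟨z, _, rfl⟩ := Finset.mem_image.1 hy
          rfl
      refine Finset.disjoint_left.2 fun y hy hy' => hvv' ?_
      exact Option.some_injective _ ((h1 v y hy).symm.trans (h1 v' y hy'))

lemma sum_arPolicy {Θ X : Type*} [Fintype V] [Nonempty V] {eos : Set V} {L : ℕ}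
    (f : Θ → X → List V → EuclideanSpace ℝ V) (ϑ : Θ) (x : X) :
    ∑ y : Output V eos L, arPolicy f ϑ x y = 1 := by
  rw [← sum_seqProb_completions eos L (fun s => softmax fun v => f ϑ x s v)
    fun s => sum_softmax _]
  exact (Finset.sum_subtype (completions eos L) (mem_completions eos L)
    (seqProb fun s => softmax fun v => f ϑ x s v)).symm ▸ rfl

/-- At most `L` softmax factors contribute `2 * |B|` each; the `+ 1` keeps the constant positive
when `L` or `B` vanishes. -/
lemma isLogLipschitz_arPolicy {Θ X : Type*} [NormedAddCommGroup Θ] [NormedSpace ℝ Θ] [Fintype V]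
    [Nonempty V] {eos : Set V} {L : ℕ} {f : Θ → X → List V → EuclideanSpace ℝ V} {U : Set Θ}
    {B : ℝ} (hf : ∀ ϑ ∈ U, ∀ (q : X) (s : List V), s.length < L →
      DifferentiableAt ℝ (fun ϑ' => f ϑ' q s) ϑ ∧ ‖fderiv ℝ (fun ϑ' => f ϑ' q s) ϑ‖ ≤ B) :
    IsLogLipschitz (arPolicy (eos := eos) (L := L) f) U (2 * L * |B| + 1) := by
  have hpos : ∀ ϑ q (y : Output V eos L), 0 ≤ arPolicy f ϑ q y := fun ϑ q y =>
    Finset.prod_nonneg fun l _ => (softmax_pos _ _).le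
  have hlen : ∀ (y : Output V eos L) (l : Fin y.1.length), (y.1.take l).length < L := by
    intro y l
    have := y.2.1
    have := l.2
    rw [List.length_take]
    omega
  have hs : ∀ ϑ ∈ U, ∀ q (y : Output V eos L) (l : Fin y.1.length), _ := fun ϑ hϑ q y l =>
    norm_fderiv_softmax_euclidean_le (hf ϑ hϑ q _ (hlen y l)).1
      ((hf ϑ hϑ q _ (hlen y l)).2.trans (le_abs_self B)) (y.1.get l)
  have hprod : ∀ ϑ ∈ U, ∀ q (y : Output V eos L), _ := fun ϑ hϑ q y =>
    norm_fderiv_prod_le (u := Finset.univ) (fun l _ => (hs ϑ hϑ q y l).1)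
      (fun l _ => (softmax_pos _ _).le) fun l _ => (hs ϑ hϑ q y l).2
  refine ⟨fun ϑ q => ⟨hpos ϑ q, sum_arPolicy f ϑ q⟩, fun ϑ hϑ q y => (hprod ϑ hϑ q y).1,
    fun ϑ hϑ q y => ?_⟩
  · refine (hprod ϑ hϑ q y).2.trans ?_
    refine mul_le_mul_of_nonneg_right ?_ (hpos ϑ q y)
    have h1 : ((Finset.univ : Finset (Fin y.1.length)).card : ℝ) ≤ L := by
      simpa using y.2.1
    have := mul_le_mul_of_nonneg_right h1 (by positivity : 0 ≤ 2 * |B|)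
    linarith

end Autoregressive

/-! ### Tabular policies and the upper bound. -/

lemma exp_sub_mul_tabularPolicy {X Y : Type*} [Fintype Y] (ϑ : EuclideanSpace ℝ (Y × X)) (x : X) (y y' : Y) :
    Real.exp (ϑ (y, x) - ϑ (y', x)) * tabularPolicy ϑ x y' = tabularPolicy ϑ x y := by
  rw [tabularPolicy, tabularPolicy, softmax, softmax, mul_div_assoc', ← Real.exp_add,
    sub_add_cancel]

/-- Test the accuracy on the point mass at a single pair. -/
lemma sign_eq_of_accuracy_eq_one {Y : Type*} {r rG : Y → ℝ} (h : ∀ D : PMF (Sym2 Y), accuracy D r rG = 1)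
    (y y' : Y) : SignType.sign (r y - r y') = SignType.sign (rG y - rG y') := by
  classical
  by_contra hne
  have h1 := h (PMF.pure s(y, y'))
  rw [accuracy, tsum_eq_single s(y, y') fun s hs => by simp [PMF.pure_apply, hs]] at h1
  simp [agree, hne] at h1

section Tabular

variable {X Y : Type*} [Fintype X] [Fintype Y]

lemma hasFDerivAt_tabularPolicy (ϑ : EuclideanSpace ℝ (Y × X)) (q : X) (y : Y) :
    HasFDerivAt (fun ϑ' => tabularPolicy ϑ' q y)
      (tabularPolicy ϑ q y • ((EuclideanSpace.proj (y, q) : EuclideanSpace ℝ (Y × X) →L[ℝ] ℝ) -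
        ∑ j, tabularPolicy ϑ q j • EuclideanSpace.proj (j, q))) ϑ :=
  hasFDerivAt_softmax (z := fun (ϑ : EuclideanSpace ℝ (Y × X)) y => ϑ (y, q))
    (fun j => (EuclideanSpace.proj (j, q) : EuclideanSpace ℝ (Y × X) →L[ℝ] ℝ).hasFDerivAt) y

lemma isLogLipschitz_tabularPolicy [Nonempty Y] :
    IsLogLipschitz (tabularPolicy (X := X) (Y := Y)) Set.univ 2 := by
  have h : ∀ (ϑ : EuclideanSpace ℝ (Y × X)) (q : X) (y : Y), _ := fun ϑ q y =>
    norm_fderiv_softmax_le (B := 1) (z := fun (ϑ : EuclideanSpace ℝ (Y × X)) y => ϑ (y, q))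
      (ϑ := ϑ)
      (fun j => (EuclideanSpace.proj (j, q) : EuclideanSpace ℝ (Y × X) →L[ℝ] ℝ).hasFDerivAt)
      (fun j => ContinuousLinearMap.opNorm_le_bound _ zero_le_one fun v => by
        rw [one_mul]
        exact PiLp.norm_apply_le v (j, q)) y
  exact ⟨fun ϑ q => softmax_mem_stdSimplex _, fun ϑ _ q y => (h ϑ q y).1,
    fun ϑ _ q y => (h ϑ q y).2.trans_eq (by rw [mul_one]; rfl)⟩

lemma gradient_noisyObjective_tabularPolicy [Nonempty Y] (pQ : PMF X) {R : X → Y → ℝ}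
    (hR : ∀ q y, R q y ∈ Set.Icc (-1) 1) (σ : ℝ≥0) (ϑ : EuclideanSpace ℝ (Y × X)) (x : X) (y : Y) :
    (∇ (noisyObjective σ pQ tabularPolicy R) ϑ) (y, x)
      = (pQ x).toReal * (tabularPolicy ϑ x y * (R x y - mean (tabularPolicy ϑ x) (R x))) := by
  classical
  have h1 : (∇ (noisyObjective σ pQ tabularPolicy R) ϑ) (y, x)
      = fderiv ℝ (noisyObjective σ pQ tabularPolicy R) ϑ (EuclideanSpace.single (y, x) 1) := by
    rw [← InnerProductSpace.toDual_symm_apply, EuclideanSpace.inner_single_right]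
    simp [gradient]
  rw [h1, (isLogLipschitz_tabularPolicy.hasFDerivAt_noisyObjective pQ isOpen_univ hR σ
    (Set.mem_univ ϑ)).fderiv, tsum_fintype]
  simp only [(hasFDerivAt_tabularPolicy ϑ _ _).fderiv, sum_apply,
    smul_apply, sub_apply, smul_eq_mul,
    EuclideanSpace.coe_proj, PiLp.single_apply, Prod.mk.injEq]
  rw [Finset.sum_eq_single x (fun q _ hq => by simp [hq]) (by simp)]
  simp only [and_true, mul_ite, mul_one, mul_zero, Finset.sum_ite_eq', Finset.mem_univ, if_true,
    mul_sub, Finset.sum_sub_distrib, mean, Finset.mul_sum]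
  congr 1
  · ring
  · exact Finset.sum_congr rfl fun j _ => by ring

lemma hasDerivWithinAt_flow_apply [Nonempty Y] {pQ : PMF X} {R : X → Y → ℝ}
    (hR : ∀ q y, R q y ∈ Set.Icc (-1) 1) {σ : ℝ≥0} {θ : ℝ → EuclideanSpace ℝ (Y × X)}
    (hflow : IsGradientFlow (noisyObjective σ pQ tabularPolicy R) θ) {t : ℝ} (ht : 0 ≤ t)
    (x : X) (y : Y) :
    HasDerivWithinAt (fun t => θ t (y, x)) ((pQ x).toReal *
      (tabularPolicy (θ t) x y * (R x y - mean (tabularPolicy (θ t) x) (R x)))) (Set.Ici 0) t := by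
  rw [← gradient_noisyObjective_tabularPolicy pQ hR σ]
  exact (EuclideanSpace.proj (𝕜 := ℝ) (y, x)).hasFDerivAt.comp_hasDerivWithinAt t (hflow t ht).2

/-- The odds `∑ π(y) / π(y₁)` of the unrewarded outputs against a rewarded one decrease along the
gradient flow at a rate at least `p_Q(x) (∑ π(y)) ^ 2`. -/
lemma exists_hasDerivWithinAt_odds_le {pQ : PMF X} {R : X → Y → ℝ}
    (hR : ∀ q y, R q y = 0 ∨ R q y = 1) {σ : ℝ≥0} {θ : ℝ → EuclideanSpace ℝ (Y × X)}
    (hflow : IsGradientFlow (noisyObjective σ pQ tabularPolicy R) θ) {x : X} {y₁ : Y}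
    (hy₁ : R x y₁ = 1) {t : ℝ} (ht : 0 ≤ t) :
    ∃ v' : ℝ, HasDerivWithinAt
        (fun t => ∑ y with R x y = 0, Real.exp (θ t (y, x) - θ t (y₁, x))) v' (Set.Ici 0) t ∧
      v' ≤ -((pQ x).toReal * (∑ y with R x y = 0, tabularPolicy (θ t) x y) ^ 2) := by
  have : Nonempty Y := ⟨y₁⟩
  have hR' : ∀ q y, R q y ∈ Set.Icc (-1) 1 := fun q y => by
    rcases hR q y with h | h <;> rw [h] <;> norm_num
  have hd := hasDerivWithinAt_flow_apply hR' hflow ht x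
  refine ⟨_, HasDerivWithinAt.fun_sum fun y _ => ((hd y).sub (hd y₁)).exp, ?_⟩
  have hp : 0 ≤ (pQ x).toReal := ENNReal.toReal_nonneg
  have hπ : ∀ y, 0 ≤ tabularPolicy (θ t) x y := fun y => (softmax_pos _ _).le
  have hm0 : 0 ≤ mean (tabularPolicy (θ t) x) (R x) := Finset.sum_nonneg fun y _ =>
    mul_nonneg (hπ y) (by rcases hR x y with h | h <;> simp [h])
  have hm1 : 1 - mean (tabularPolicy (θ t) x) (R x)
      = ∑ y with R x y = 0, tabularPolicy (θ t) x y := by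
    rw [← sum_softmax (fun y => θ t (y, x)), mean, ← Finset.sum_sub_distrib, Finset.sum_filter]
    refine Finset.sum_congr rfl fun y _ => ?_
    rcases hR x y with h | h <;> simp [h, tabularPolicy]
  rw [hy₁, hm1]
  set N := ∑ y with R x y = 0, tabularPolicy (θ t) x y with hN
  have hsum : -((pQ x).toReal * N ^ 2)
      = ∑ y with R x y = 0, -((pQ x).toReal * N * tabularPolicy (θ t) x y) := by
    rw [Finset.sum_neg_distrib, ← Finset.mul_sum, ← hN]
    ring
  rw [hsum]
  refine Finset.sum_le_sum fun y hy => ?_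
  rw [(Finset.mem_filter.1 hy).2, ← exp_sub_mul_tabularPolicy (θ t) x y y₁, zero_sub]
  -- This is the decay due to the unrewarded logits themselves falling; it is discarded, and the
  -- rise of the logit of `y₁` alone gives the rate.
  have h1 : 0 ≤ (pQ x).toReal * (Real.exp (θ t (y, x) - θ t (y₁, x)) * tabularPolicy (θ t) x y₁ *
      mean (tabularPolicy (θ t) x) (R x)) * Real.exp (θ t (y, x) - θ t (y₁, x)) := by
    have := hπ y₁
    positivity
  simp only [Pi.sub_apply]
  linarith

lemma riseTime_tabularPolicy_le {w δ γ : ℝ} (hw : 0 < w) (hδ : 0 < δ) (hγ : 0 < γ) {pQ : PMF X}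
    {R rG : X → Y → ℝ} {σ : ℝ≥0} {θ : ℝ → EuclideanSpace ℝ (Y × X)} {x : X} {y₁ : Y}
    (hR : ∀ q y, R q y = 0 ∨ R q y = 1) (hrG : ∀ q y, rG q y ∈ Set.Icc (-1) 1)
    (hacc : ∀ D : PMF (Sym2 Y), accuracy D (R x) (rG x) = 1)
    (hflow : IsGradientFlow (noisyObjective σ pQ tabularPolicy R) θ) (hwx : w ≤ (pQ x).toReal)
    (hy : mean (tabularPolicy (θ 0) x) (rG x) + γ + δ ≤ rG x y₁) :
    riseTime tabularPolicy θ rG x γ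
      ≤ ENNReal.ofReal (4 / (w * δ ^ 2) * (tabularPolicy (θ 0) x y₁)⁻¹) := by
  have : Nonempty Y := ⟨y₁⟩
  have hsign := sign_eq_of_accuracy_eq_one hacc
  have hπ : ∀ t y, 0 < tabularPolicy (θ t) x y := fun t y => softmax_pos _ _
  have hsum : ∀ t, ∑ y, tabularPolicy (θ t) x y = 1 := fun t => sum_softmax _
  -- An unrewarded `y₁` would minimise `R x`, hence also `rG x`, and could not exceed the mean.
  have hy₁ : R x y₁ = 1 := by
    refine (hR x y₁).resolve_left fun h0 => ?_
    have hle : ∀ y, rG x y₁ ≤ rG x y := by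
      intro y
      have h1 : 0 ≤ SignType.sign (R x y - R x y₁) := by
        rw [sign_nonneg_iff]
        rcases hR x y with h | h <;> simp [h, h0]
      rw [hsign, sign_nonneg_iff] at h1
      linarith
    have h2 : ∑ y, tabularPolicy (θ 0) x y * rG x y₁ ≤ mean (tabularPolicy (θ 0) x) (rG x) :=
      Finset.sum_le_sum fun y _ => mul_le_mul_of_nonneg_left (hle y) (hπ 0 y).le
    rw [← Finset.sum_mul, hsum, one_mul] at h2
    linarith
  have heq : ∀ y, R x y = 1 → rG x y = rG x y₁ := by
    intro y h
    have h1 := hsign y y₁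
    rw [h, hy₁, sub_self, sign_zero, eq_comm, sign_eq_zero_iff] at h1
    linarith
  by_contra! hlt
  set T := 4 / (w * δ ^ 2) * (tabularPolicy (θ 0) x y₁)⁻¹ with hT
  have hT0 : 0 ≤ T := mul_nonneg (by positivity) (inv_nonneg.2 (hπ 0 y₁).le)
  -- Before the rise the mean is more than `δ` below `rG x y₁`; only unrewarded outputs create this
  -- gap, each by at most 2.
  have hN : ∀ t ∈ Set.Icc 0 T, δ / 2 ≤ ∑ y with R x y = 0, tabularPolicy (θ t) x y := by
    intro t ht
    have hnot : mean (tabularPolicy (θ t) x) (rG x)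
        < mean (tabularPolicy (θ 0) x) (rG x) + γ := by
      by_contra! hrise
      refine hlt.not_ge ((iInf₂_le (⟨t, ht.1⟩ : ℝ≥0) hrise).trans ?_)
      exact ENNReal.coe_le_coe.2 (NNReal.le_toNNReal_of_coe_le ht.2)
    have h1 : rG x y₁ - mean (tabularPolicy (θ t) x) (rG x)
        = ∑ y with R x y = 0, tabularPolicy (θ t) x y * (rG x y₁ - rG x y) := by
      rw [Finset.sum_filter_of_ne]
      · simp only [mul_sub, Finset.sum_sub_distrib, ← Finset.sum_mul, hsum, one_mul, mean]
      · intro y _ hne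
        refine (hR x y).resolve_right fun h => hne ?_
        rw [heq y h, sub_self, mul_zero]
    have h2 : ∑ y with R x y = 0, tabularPolicy (θ t) x y * (rG x y₁ - rG x y)
        ≤ ∑ y with R x y = 0, tabularPolicy (θ t) x y * 2 :=
      Finset.sum_le_sum fun y _ => mul_le_mul_of_nonneg_left
        (by linarith [(hrG x y).1, (hrG x y₁).2]) (hπ t y).le
    rw [← Finset.sum_mul] at h2
    linarith
  set v : ℝ → ℝ := fun t => ∑ y with R x y = 0, Real.exp (θ t (y, x) - θ t (y₁, x)) with hv
  have hmul : ∀ t, v t * tabularPolicy (θ t) x y₁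
      = ∑ y with R x y = 0, tabularPolicy (θ t) x y := fun t => by
    simp only [hv, Finset.sum_mul, exp_sub_mul_tabularPolicy]
  choose! v' hv' hv'le using fun t (ht : 0 ≤ t) =>
    exists_hasDerivWithinAt_odds_le hR hflow hy₁ ht
  have hB : ∀ t, HasDerivAt (fun t => v 0 - w * (δ / 2) ^ 2 * t) (-(w * (δ / 2) ^ 2)) t := by
    intro t
    simpa using ((hasDerivAt_id t).const_mul (w * (δ / 2) ^ 2)).const_sub (v 0)
  have key := image_le_of_deriv_right_le_deriv_boundary (f := v) (f' := v') (a := 0) (b := T)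
    (fun t ht => (hv' t ht.1).continuousWithinAt.mono Set.Icc_subset_Ici_self)
    (fun t ht => (hv' t ht.1).mono (Set.Ici_subset_Ici.2 ht.1))
    (B := fun t => v 0 - w * (δ / 2) ^ 2 * t) (by simp)
    (fun t _ => (hB t).continuousAt.continuousWithinAt) (fun t _ => (hB t).hasDerivWithinAt)
    (fun t ht => (hv'le t ht.1).trans <| neg_le_neg <| mul_le_mul hwx
      (pow_le_pow_left₀ (by positivity) (hN t (Set.Ico_subset_Icc_self ht)) 2) (by positivity)
      (hw.le.trans hwx)) (Set.right_mem_Icc.2 hT0)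
  have h0 : v 0 ≤ (tabularPolicy (θ 0) x y₁)⁻¹ := by
    rw [← one_div, le_div_iff₀ (hπ 0 y₁), hmul, ← hsum 0]
    exact Finset.sum_le_sum_of_subset_of_nonneg (Finset.filter_subset _ _)
      fun y _ _ => (hπ 0 y).le
  have hT' : w * (δ / 2) ^ 2 * T = (tabularPolicy (θ 0) x y₁)⁻¹ := by
    rw [hT]
    field_simp
    norm_num
  -- `T` is the initial bound on the odds divided by the guaranteed rate of decay. Vanishing odds
  -- contradict the mass `δ / 2` still present.
  have hvT : v T ≤ 0 := by
    beta_reduce at key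
    linarith
  have h1 := hN T (Set.right_mem_Icc.2 hT0)
  rw [← hmul] at h1
  have h2 := mul_nonpos_of_nonpos_of_nonneg hvT (hπ T y₁).le
  linarith

end Tabular

end ReDit

theorem proposition3 :
    -- The reward variance rises by exactly `σ²`.
    (∀ (Y : Type*) [Fintype Y] (σ : ℝ≥0) (p r : Y → ℝ), p ∈ stdSimplex ℝ Y →
      ReDit.noisyRewardVar σ p r = ReDit.rewardVar p r + (σ : ℝ) ^ 2) ∧
    -- The accuracy of a perfect reward drops.
    (∀ (Y : Type*) (σ : ℝ≥0) (D : PMF (Sym2 Y)) (r rG : Y → ℝ), 0 < σ →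
      ReDit.accuracy D r rG = 1 →
      ReDit.noisyAccuracy σ D r rG < ReDit.accuracy D r rG) ∧
    -- Lower bound on `t_γ` for general autoregressive policies.
    (∀ (γ B : ℝ) (L : ℕ), 0 < γ → ∃ c : ℝ, 0 < c ∧
      ∀ (Θ : Type*) [NormedAddCommGroup Θ] [InnerProductSpace ℝ Θ] [CompleteSpace Θ]
        (X V : Type*) [Fintype V] [Nonempty V] (eos : Set V)
        (f : Θ → X → List V → EuclideanSpace ℝ V) (U : Set Θ)
        (pQ : PMF X) (R rG : X → ReDit.Output V eos L → ℝ) (σ : ℝ≥0) (θ : ℝ → Θ) (x : X),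
        IsOpen U →
        (∀ ϑ ∈ U, ∀ (q : X) (s : List V), s.length < L →
          DifferentiableAt ℝ (fun ϑ' => f ϑ' q s) ϑ ∧
            ‖fderiv ℝ (fun ϑ' => f ϑ' q s) ϑ‖ ≤ B) →
        (∀ q y, R q y ∈ Set.Icc (-1) 1) →
        (∀ q y, rG q y ∈ Set.Icc (-1) 1) →
        ReDit.IsGradientFlow (ReDit.noisyObjective σ pQ (ReDit.arPolicy f) R) θ →
        (∀ t, 0 ≤ t → θ t ∈ U) →
        ENNReal.ofReal c * ENNReal.ofReal
            (ReDit.avgRewardVar pQ (ReDit.arPolicy f) R (θ 0) + (σ : ℝ) ^ 2) ^ (-(1 / 3) : ℝ)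
          ≤ ReDit.riseTime (ReDit.arPolicy f) θ rG x γ) ∧
    -- Both bounds on `t_γ` for tabular policies and a perfect binary reward.
    (∀ γ : ℝ, 0 < γ → ∃ c : ℝ, 0 < c ∧ ∀ w δ : ℝ, 0 < w → 0 < δ → ∃ C : ℝ, 0 < C ∧
      ∀ (X Y : Type*) [Fintype X] [Fintype Y]
        (pQ : PMF X) (R rG : X → Y → ℝ) (σ : ℝ≥0) (θ : ℝ → EuclideanSpace ℝ (Y × X))
        (x : X) (yγ : Y),
        (∀ q y, R q y = 0 ∨ R q y = 1) →
        (∀ q y, rG q y ∈ Set.Icc (-1) 1) →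
        (∀ D : PMF (Sym2 Y), ReDit.accuracy D (R x) (rG x) = 1) →
        ReDit.IsGradientFlow (ReDit.noisyObjective σ pQ ReDit.tabularPolicy R) θ →
        w ≤ (pQ x).toReal →
        ReDit.mean (ReDit.tabularPolicy (θ 0) x) (rG x) + γ + δ ≤ rG x yγ →
        ENNReal.ofReal c * ENNReal.ofReal
            (ReDit.avgRewardVar pQ ReDit.tabularPolicy R (θ 0) + (σ : ℝ) ^ 2) ^ (-(1 / 3) : ℝ)
          ≤ ReDit.riseTime ReDit.tabularPolicy θ rG x γ ∧
        ReDit.riseTime ReDit.tabularPolicy θ rG x γ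
          ≤ ENNReal.ofReal (C * (ReDit.tabularPolicy (θ 0) x yγ)⁻¹)) := by
  refine ⟨fun Y _ σ p r hp => ReDit.noisyRewardVar_eq σ p r hp, fun Y σ D r rG hσ h => ?_,
    fun γ B L hγ => ?_, fun γ hγ => ?_⟩
  · rw [h]
    exact ReDit.noisyAccuracy_lt_one hσ D r rG
  · refine ⟨min 1 γ / (2 * (2 * L * |B| + 1) ^ 2), by positivity, ?_⟩
    intro Θ _ _ _ X V _ _ eos f U pQ R rG σ θ x hU hf hR hrG hflow hθ
    exact ReDit.le_riseTime (ReDit.isLogLipschitz_arPolicy hf) hU (by positivity) hγ hR hrG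
      hflow hθ
  · refine ⟨min 1 γ / (2 * 2 ^ 2), by positivity, fun w δ hw hδ =>
      ⟨4 / (w * δ ^ 2), by positivity, ?_⟩⟩
    intro X Y _ _ pQ R rG σ θ x yγ hR hrG hacc hflow hwx hy
    have : Nonempty Y := ⟨yγ⟩
    refine ⟨ReDit.le_riseTime ReDit.isLogLipschitz_tabularPolicy isOpen_univ two_pos hγ
      (fun q y => ?_) hrG hflow fun _ _ => Set.mem_univ _,
      ReDit.riseTime_tabularPolicy_le hw hδ hγ hR hrG hacc hflow hwx hy⟩
    rcases hR q y with h | h <;> rw [h] <;> norm_num
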